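/- Let $n\ge 2$ be an integer, let $d$ be an odd, positive, square-free integer, and let $S=\mathrm{diag}(1,\ldots,1,-d)$ be the $(n+1)\times(n+1)$ matrix of the quadratic form $x_1^2+\cdots+x_n^2-d\,x_{n+1}^2$. Let $E_8(S)$ be the number of $(n+1)\times(n+1)$ matrices $A$ over $\mathbb{Z}/8\mathbb{Z}$ such that $A^tSA=S$. Then $$\frac{2\cdot 2^{\frac{3n(n+1)}{2}}}{E_8(S)}=\frac{2^{\frac{n-1}{2}}+\cos\!\left(\left(n+(-1)^{\frac{d+1}{2}}\right)\frac{\pi}{4}\right)}{2^{\frac{n+3}{2}}\displaystyle\prod_{k=1}^{[n/2]}\left(1-2^{-2k}\right)},$$ where $[n/2]$ denotes the integer part of $n/2$. -/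

import Mathlib

/-- `numUnits q S` is the number of square matrices `A` over `ℤ/qℤ` with `Aᵀ S A = S`,
where the integral matrix `S` is read modulo `q` (for a positive integer `q`). -/
noncomputable def numUnits (q : ℕ) {m : ℕ} (S : Matrix (Fin m) (Fin m) ℤ) : ℕ :=
  Nat.card {A : Matrix (Fin m) (Fin m) (ZMod q) //
    A.transpose * S.map (Int.cast : ℤ → ZMod q) * A = S.map (Int.cast : ℤ → ZMod q)}

/-- The `(n + 1) × (n + 1)` matrix `diag(1, …, 1, -d)` of the quadratic form
`x₁² + ⋯ + xₙ² - d xₙ₊₁²`. -/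
def formMatrix (n d : ℕ) : Matrix (Fin (n + 1)) (Fin (n + 1)) ℤ :=
  Matrix.diagonal (fun i => if i = Fin.last n then -(d : ℤ) else 1)

/-!
The columns of a matrix `A` with `Aᵀ S A = S` form a frame: vectors of `(ℤ/8)ⁿ⁺¹`, pairwise
orthogonal for `S`, of norms `1, …, 1, -d`. Frames are counted one vector at a time. If `v` has norm
`1`, then the ambient module is `⟨v⟩ ⊕ v^⊥`, and the remaining vectors form a frame of `v^⊥`. The
complement need not be diagonalizable: it is even exactly when `v` is characteristic, meaning that
`B(v, y) ≡ B(y, y)` modulo `2` for all `y`, and then it contributes no frame at all.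

No classification of forms over `ℤ/8` is needed for the other complements. It is enough to follow
a few numbers (`HasDiagonalInvariants`): the order of the module, the number and the common norm of
the characteristic vectors, and the Gauss sum `∑ i ^ B(x, x)`. They pass from `B` to `v^⊥`
(`HasDiagonalInvariants.ker`), and they determine the number of non-characteristic vectors of norm
`1` (`HasDiagonalInvariants.card_norm_one`): the Gauss sum gives the number of vectors whose norm is
`1` modulo `4`, and outside the characteristic vectors the norms `1` and `5` are equally frequent,
because the translations `v ↦ v + 2w` exchange them. Hence the number of frames satisfies a
one-term recursion (`HasDiagonalInvariants.card_frames`).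

The Gauss sum of the diagonal form is `4ⁿ⁺¹ (1 + i)ⁿ (1 ± i)`, a power of `√2` times
`exp ((n ± 1) π i / 4)`, which is where the cosine comes from; the recursion telescopes to the
product formula (`frameCount_mul`) by an identity checked for each class of `n ± 1` modulo `8`
(`normOneCount_factor`).
-/

/-! ### The quartic character and forms over `ℤ/8` -/

/-- The additive character `t ↦ i ^ t` of `ℤ/8`, of order `4`, with values in `ℤ[i]`. -/
noncomputable def quarticChar : AddChar (ZMod 8) GaussianInt :=
  AddChar.zmodChar 8 (ζ := (⟨0, 1⟩ : GaussianInt)) (by decide)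

lemma quarticChar_im (t : ZMod 8) :
    (quarticChar t).im = (if t = 1 ∨ t = 5 then 1 else 0) - (if t = 3 ∨ t = 7 then 1 else 0) := by
  rw [quarticChar, AddChar.zmodChar_apply]
  revert t; decide

lemma sum_quarticChar_sq {a : ZMod 8} (ha : 4 * a = 4) :
    ∑ t : ZMod 8, quarticChar (a * t ^ 2) = 4 * (1 + quarticChar a) := by
  simp only [quarticChar, AddChar.zmodChar_apply]
  revert a; decide

/-- A nonzero homomorphism into `{0, 4} ⊆ ℤ/8` is nonzero on exactly half of its source. -/
lemma two_mul_card_filter_ne_zero {V : Type*} [AddCommGroup V] [Fintype V]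
    (φ : V →+ ZMod 8) (h4 : ∀ x, φ x = 0 ∨ φ x = 4)
    {z : V} (hz : φ z ≠ 0) : 2 * (Finset.univ.filter fun x => φ x ≠ 0).card = Fintype.card V := by
  classical
  have hz4 : φ z = 4 := (h4 z).resolve_left hz
  have e : (Finset.univ.filter fun x => φ x ≠ 0).card
      = (Finset.univ.filter fun x => ¬ φ x ≠ 0).card := by
    refine Finset.card_equiv (Equiv.addRight z) fun x => ?_
    have h8 : (4 : ZMod 8) + 4 = 0 := by decide
    have h40 : (4 : ZMod 8) ≠ 0 := by decide
    rcases h4 x with h | h <;> simp [h, hz4, h8, h40]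
  have := Finset.card_filter_add_card_filter_not (s := (Finset.univ : Finset V)) (fun x => φ x ≠ 0)
  rw [Finset.card_univ] at this
  omega

variable {V : Type*} [AddCommGroup V] [Module (ZMod 8) V]

/-- The characteristic vectors of `B`: those `x` with `B(x, y) ≡ B(y, y)` modulo `2` for all `y`. The
congruence is written as an equality in `ℤ/8` after multiplication by `4`. -/
def characteristicVectors (B : LinearMap.BilinForm (ZMod 8) V) : Set V :=
  {x | ∀ y, 4 * B x y = 4 * B y y}

/-- `B` is a symmetric form that shares with the diagonal form `⟨1, …, 1, a⟩` (`r` ones) the numbers on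
which the number of frames depends: the order of the module, the number and the common norm of the
characteristic vectors, the existence of a vector of odd norm, and the Gauss sum of the quartic
character. Nondegeneracy is not assumed separately. -/
structure HasDiagonalInvariants [Fintype V] (B : LinearMap.BilinForm (ZMod 8) V)
    (r : ℕ) (a : ZMod 8) : Prop where
  symm : ∀ x y, B x y = B y x
  card_eq : Nat.card V = 8 ^ (r + 1)
  card_char : Nat.card (characteristicVectors B) = 4 ^ (r + 1)
  norm_char : ∀ x ∈ characteristicVectors B, B x x = r + a
  odd : ∃ z, 4 * B z z ≠ 0
  gauss : ∑ x, quarticChar (B x x) =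
    4 ^ (r + 1) * ((1 + ⟨0, 1⟩) ^ r * (1 + quarticChar a))

lemma zmod8_four_mul (t : ZMod 8) : 4 * t = 0 ∨ 4 * t = 4 := by revert t; decide

lemma zmod8_eight : (8 : ZMod 8) = 0 := by decide

lemma norm_add {B : LinearMap.BilinForm (ZMod 8) V} (hB : ∀ x y, B x y = B y x) (x y : V) :
    B (x + y) (x + y) = B x x + B y y + 2 * B x y := by
  simp only [map_add, LinearMap.add_apply, hB y x]; ring

/-- The norm modulo `2`, written as `4 * B x x`, is additive. -/
def normParity (B : LinearMap.BilinForm (ZMod 8) V) (hB : ∀ x y, B x y = B y x) : V →+ ZMod 8 where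
  toFun x := 4 * B x x
  map_zero' := by simp
  map_add' x y := by
    rw [norm_add hB]
    linear_combination B x y * zmod8_eight

lemma two_mul_card_odd_norm [Fintype V] {B : LinearMap.BilinForm (ZMod 8) V}
    (hB : ∀ x y, B x y = B y x) (hodd : ∃ z, 4 * B z z ≠ 0) :
    2 * (Finset.univ.filter fun x => 4 * B x x ≠ 0).card = Fintype.card V := by
  obtain ⟨z, hz⟩ := hodd
  exact two_mul_card_filter_ne_zero (normParity B hB) (fun x => zmod8_four_mul _) hz

open Classical in
/-- Half of the vectors have odd norm, and the imaginary part of the Gauss sum is the excess of the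
norms `1` modulo `4` over the norms `3` modulo `4`. -/
lemma card_norm_one_or_five [Fintype V] {B : LinearMap.BilinForm (ZMod 8) V}
    (hB : ∀ x y, B x y = B y x) (hodd : ∃ z, 4 * B z z ≠ 0) :
    4 * ((Finset.univ.filter fun x => B x x = 1 ∨ B x x = 5).card : ℤ) =
      Fintype.card V + 2 * (∑ x, quarticChar (B x x)).im := by
  have h1 := two_mul_card_odd_norm hB hodd
  have him : (∑ x, quarticChar (B x x)).im =
      ((Finset.univ.filter fun x => B x x = 1 ∨ B x x = 5).card : ℤ) -
        ((Finset.univ.filter fun x => B x x = 3 ∨ B x x = 7).card : ℤ) := by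
    have : ∀ z : GaussianInt, z.im = AddMonoidHom.mk' (fun z : GaussianInt => z.im)
      (fun _ _ => rfl) z := fun _ => rfl
    rw [this, map_sum]
    simp only [← this, quarticChar_im, Finset.sum_sub_distrib, Finset.sum_boole]
  have h2 : (Finset.univ.filter fun x => 4 * B x x ≠ 0).card =
      (Finset.univ.filter fun x => B x x = 1 ∨ B x x = 5).card +
        (Finset.univ.filter fun x => B x x = 3 ∨ B x x = 7).card := by
    rw [← Finset.card_union_of_disjoint, ← Finset.filter_or]
    · congr 1
      ext x
      simp only [Finset.mem_filter, Finset.mem_univ, true_and]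
      generalize B x x = t
      revert t; decide
    · rw [Finset.disjoint_filter]
      intro x _
      generalize B x x = t
      revert t; decide
  rw [him]
  omega

open Classical in
/-- Double counting of the pairs `(v, w)` for which the translation `v ↦ v + 2w` changes the norm of
`v` by `4`: it exchanges the norms `1` and `5`, and for each non-characteristic `v` half of the `w`
qualify. -/
lemma card_not_char_norm_eq [Fintype V] {B : LinearMap.BilinForm (ZMod 8) V}
    (hB : ∀ x y, B x y = B y x) :
    (Finset.univ.filter fun v => v ∉ characteristicVectors B ∧ B v v = 1).card =
      (Finset.univ.filter fun v => v ∉ characteristicVectors B ∧ B v v = 5).card := by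
  -- `O v` is the set of `w` for which `v + 2w` and `v` have different norms
  set O : V → Finset V := fun v => Finset.univ.filter fun w => 4 * B v w + 4 * B w w ≠ 0 with hO
  have hO2 : ∀ v ∉ characteristicVectors B, 2 * (O v).card = Fintype.card V := by
    intro v hv
    simp only [characteristicVectors, Set.mem_ofPred_eq, not_forall] at hv
    obtain ⟨z, hz⟩ := hv
    let φ : V →+ ZMod 8 := AddMonoidHom.mk' (fun w => 4 * B v w + 4 * B w w) (by
      intro x y
      rw [norm_add hB, map_add]
      linear_combination B x y * zmod8_eight)
    refine two_mul_card_filter_ne_zero φ (fun x => ?_) (z := z) ?_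
    · change 4 * B v x + 4 * B x x = 0 ∨ 4 * B v x + 4 * B x x = 4
      rw [← mul_add]; exact zmod8_four_mul _
    · change 4 * B v z + 4 * B z z ≠ 0
      revert hz
      generalize B v z = s
      generalize B z z = t
      revert s t; decide
  have hpos : 0 < Fintype.card V := Fintype.card_pos
  set P : ZMod 8 → Finset V := fun t =>
    Finset.univ.filter fun v => v ∉ characteristicVectors B ∧ B v v = t with hP
  have key : ((P 1).sigma O).card = ((P 5).sigma O).card := by
    have hnorm : ∀ v w, B (v + 2 • w) (v + 2 • w) = B v v + (4 * B v w + 4 * B w w) := by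
      intro v w
      rw [norm_add hB]
      simp only [map_nsmul, LinearMap.smul_apply, nsmul_eq_mul]
      push_cast; ring
    have hpair : ∀ v w y, 4 * B (v + 2 • w) y = 4 * B v y := by
      intro v w y
      simp only [map_add, LinearMap.add_apply, map_nsmul, LinearMap.smul_apply, nsmul_eq_mul]
      push_cast
      linear_combination B w y * zmod8_eight
    have hchar : ∀ v w, v + 2 • w ∈ characteristicVectors B ↔ v ∈ characteristicVectors B := by
      intro v w
      simp only [characteristicVectors, Set.mem_ofPred_eq, hpair]
    let e : (Σ _ : V, V) ≃ (Σ _ : V, V) :=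
      { toFun := fun p => ⟨p.1 + 2 • p.2, p.2⟩
        invFun := fun p => ⟨p.1 - 2 • p.2, p.2⟩
        left_inv := fun p => by simp
        right_inv := fun p => by simp }
    refine Finset.card_equiv e ?_
    rintro ⟨v, w⟩
    simp only [Finset.mem_sigma, hP, hO, Finset.mem_filter, Finset.mem_univ, true_and, e,
      Equiv.coe_fn_mk, hchar, hpair, hnorm]
    generalize B v w = s
    generalize B w w = t
    generalize B v v = u
    have : ∀ u s t : ZMod 8, 4 * s + 4 * t ≠ 0 → (u = 1 ↔ u + (4 * s + 4 * t) = 5) := by decide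
    constructor
    · rintro ⟨⟨h1, h2⟩, h3⟩
      exact ⟨⟨h1, (this u s t h3).1 h2⟩, h3⟩
    · rintro ⟨⟨h1, h2⟩, h3⟩
      exact ⟨⟨h1, (this u s t h3).2 h2⟩, h3⟩
  have hcard : ∀ t, 2 * ((P t).sigma O).card = (P t).card * Fintype.card V := by
    intro t
    rw [Finset.card_sigma, Finset.mul_sum, Finset.sum_congr rfl (fun v hv => hO2 v ?_)]
    · simp
    · simp only [hP, Finset.mem_filter] at hv
      exact hv.2.1
  have := (hcard 1).symm.trans ((congrArg _ key).trans (hcard 5))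
  exact Nat.eq_of_mul_eq_mul_right hpos this

/-- The number of non-characteristic vectors of norm `1` for a form with the invariants of
`⟨1, …, 1, a⟩` (`r` ones), see `HasDiagonalInvariants.card_norm_one`. The condition
`r + a ∈ {1, 5}` says that the characteristic vectors have norm `1` modulo `4`. -/
def normOneCount (r : ℕ) (a : ZMod 8) : ℤ :=
  8 ^ r + 4 ^ r * (((1 + ⟨0, 1⟩ : GaussianInt) ^ r * (1 + (⟨0, 1⟩ : GaussianInt) ^ a.val)).im -
    2 * if (r + a : ZMod 8) = 1 ∨ (r + a : ZMod 8) = 5 then 1 else 0)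

open Classical in
lemma HasDiagonalInvariants.card_norm_one [Fintype V] {B : LinearMap.BilinForm (ZMod 8) V}
    {r : ℕ} {a : ZMod 8} (h : HasDiagonalInvariants B r a) :
    ((Finset.univ.filter fun v => v ∉ characteristicVectors B ∧ B v v = 1).card : ℤ) =
      normOneCount r a := by
  have h1 := card_norm_one_or_five h.symm h.odd
  have h2 := card_not_char_norm_eq h.symm
  have h3 : (Finset.univ.filter fun x => B x x = 1 ∨ B x x = 5).card =
      (Finset.univ.filter fun v => v ∉ characteristicVectors B ∧ B v v = 1).card +
      (Finset.univ.filter fun v => v ∉ characteristicVectors B ∧ B v v = 5).card +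
      (Finset.univ.filter fun v => v ∈ characteristicVectors B ∧ (B v v = 1 ∨ B v v = 5)).card := by
    rw [← Finset.card_filter_add_card_filter_not (fun v => v ∉ characteristicVectors B),
      Finset.filter_filter, Finset.filter_filter]
    congr 1
    · rw [← Finset.card_union_of_disjoint, ← Finset.filter_or]
      · congr 1
        ext x; simp only [Finset.mem_filter]; tauto
      · rw [Finset.disjoint_filter]
        rintro x _ ⟨_, h⟩ ⟨_, h'⟩
        rw [h] at h'
        exact absurd h' (by decide)
    · congr 1
      ext x; simp only [Finset.mem_filter]; tauto
  have h4 : (Finset.univ.filter fun v => v ∈ characteristicVectors B ∧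
      (B v v = 1 ∨ B v v = 5)).card =
      4 ^ (r + 1) * if (r + a : ZMod 8) = 1 ∨ (r + a : ZMod 8) = 5 then 1 else 0 := by
    rw [← h.card_char, Nat.card_eq_fintype_card, ← Set.toFinset_card]
    split_ifs with hc
    · rw [mul_one]; congr 1
      ext x
      simp only [Finset.mem_filter, Finset.mem_univ, true_and, Set.mem_toFinset]
      exact ⟨fun hx => hx.1, fun hx => ⟨hx, by rwa [h.norm_char x hx]⟩⟩
    · rw [mul_zero, Finset.card_eq_zero, Finset.filter_eq_empty_iff]
      rintro x - ⟨hx, hx'⟩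
      rw [h.norm_char x hx] at hx'
      exact hc hx'
  have hc : (Fintype.card V : ℤ) = 8 ^ (r + 1) := by
    rw [← Nat.card_eq_fintype_card, h.card_eq]; push_cast; rfl
  have h5 : (∑ x, quarticChar (B x x)).im =
      4 ^ (r + 1) * ((1 + ⟨0, 1⟩ : GaussianInt) ^ r *
        (1 + (⟨0, 1⟩ : GaussianInt) ^ a.val)).im := by
    rw [h.gauss, quarticChar, AddChar.zmodChar_apply]
    have : (4 ^ (r + 1) : GaussianInt) = ((4 ^ (r + 1) : ℤ) : GaussianInt) := by push_cast; rfl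
    rw [this, Zsqrtd.im_smul]
  rw [h5, hc, h3, h4] at h1
  rw [← h2] at h1
  rw [normOneCount]
  push_cast at h1
  rw [pow_succ, pow_succ] at h1
  linarith

/-! ### Splitting off a vector of norm one and counting frames -/

/-- The splitting `⟨v⟩ ⊕ v^⊥` of the module along a vector `v` of norm `1`. -/
def orthogonalSplitting (B : LinearMap.BilinForm (ZMod 8) V) (v : V) (hv : B v v = 1) :
    ZMod 8 × LinearMap.ker (B v) ≃ V where
  toFun p := p.1 • v + p.2
  invFun x := (B v x, ⟨x - B v x • v, by simp [hv]⟩)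
  left_inv := by
    rintro ⟨t, x, hx⟩
    rw [LinearMap.mem_ker] at hx
    simp [hv, hx]
  right_inv x := by simp

lemma orthogonalSplitting_pairing {B : LinearMap.BilinForm (ZMod 8) V}
    (hB : ∀ x y, B x y = B y x) {v : V} (hv : B v v = 1) (p q : ZMod 8 × LinearMap.ker (B v)) :
    B (orthogonalSplitting B v hv p) (orthogonalSplitting B v hv q) =
      p.1 * q.1 + B.restrict (LinearMap.ker (B v)) p.2 q.2 := by
  have h1 : B v q.2 = 0 := q.2.2
  have h2 : B p.2 v = 0 := (hB _ _).trans p.2.2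
  simp [orthogonalSplitting, hv, h1, h2]

lemma orthogonalSplitting_mem_char_iff {B : LinearMap.BilinForm (ZMod 8) V}
    (hB : ∀ x y, B x y = B y x) {v : V} (hv : B v v = 1) (p : ZMod 8 × LinearMap.ker (B v)) :
    orthogonalSplitting B v hv p ∈ characteristicVectors B ↔
      4 * p.1 = 4 ∧ p.2 ∈ characteristicVectors (B.restrict (LinearMap.ker (B v))) := by
  simp only [characteristicVectors, Set.mem_ofPred_eq]
  rw [(orthogonalSplitting B v hv).surjective.forall]
  simp only [orthogonalSplitting_pairing hB hv, Prod.forall]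
  constructor
  · intro h
    exact ⟨by simpa using h 1 0, fun y => by simpa using h 0 y⟩
  · rintro ⟨h1, h2⟩ t y
    rw [mul_add, h2 y, mul_add, ← mul_assoc, h1]
    congr 1
    revert t; decide

/-- The characteristic vectors of norm `1` are the vectors of norm `1` whose complement is even. -/
lemma mem_char_iff_ker_even {B : LinearMap.BilinForm (ZMod 8) V}
    (hB : ∀ x y, B x y = B y x) {v : V} (hv : B v v = 1) :
    v ∈ characteristicVectors B ↔ ∀ x ∈ LinearMap.ker (B v), 4 * B x x = 0 := by
  have h := orthogonalSplitting_mem_char_iff hB hv (1, 0)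
  have hv1 : orthogonalSplitting B v hv (1, 0) = v := by simp [orthogonalSplitting]
  rw [hv1] at h
  rw [h]
  simp [characteristicVectors, eq_comm]

/-- Splitting off a non-characteristic vector of norm `1` removes one entry `1` from the diagonal form
whose invariants `B` has. -/
lemma HasDiagonalInvariants.ker [Fintype V] {B : LinearMap.BilinForm (ZMod 8) V}
    {r : ℕ} {a : ZMod 8} (h : HasDiagonalInvariants B (r + 1) a) {v : V} (hv : B v v = 1)
    (hchar : v ∉ characteristicVectors B) [Fintype (LinearMap.ker (B v))] :
    HasDiagonalInvariants (B.restrict (LinearMap.ker (B v))) r a := by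
  let e := orthogonalSplitting B v hv
  refine ⟨fun x y => h.symm x y, ?_, ?_, ?_, ?_, ?_⟩
  · have h1 := Nat.card_congr e
    rw [Nat.card_prod, h.card_eq, Nat.card_zmod, pow_succ'] at h1
    exact Nat.eq_of_mul_eq_mul_left (by norm_num) h1
  · have h1 : Nat.card ({t : ZMod 8 | 4 * t = 4} ×ˢ
        characteristicVectors (B.restrict (LinearMap.ker (B v))) : Set _) =
        Nat.card (characteristicVectors B) :=
      Nat.card_congr (e.subtypeEquiv fun p => (orthogonalSplitting_mem_char_iff h.symm hv p).symm)
    have h2 : Nat.card ({t : ZMod 8 | 4 * t = 4} : Set _) = 4 := by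
      rw [Nat.card_eq_fintype_card]; decide
    rw [Nat.card_congr (Equiv.Set.prod _ _), Nat.card_prod, h.card_char, h2, pow_succ'] at h1
    exact Nat.eq_of_mul_eq_mul_left (by norm_num) h1
  · intro x hx
    have h1 := h.norm_char _
      ((orthogonalSplitting_mem_char_iff h.symm hv (1, x)).2 ⟨mul_one _, hx⟩)
    rw [orthogonalSplitting_pairing h.symm hv] at h1
    push_cast at h1
    linear_combination h1
  · rw [mem_char_iff_ker_even h.symm hv] at hchar
    push Not at hchar
    obtain ⟨z, hz, hz'⟩ := hchar
    exact ⟨⟨z, hz⟩, hz'⟩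
  · have h1 := h.gauss
    rw [← e.sum_comp] at h1
    simp only [e, orthogonalSplitting_pairing h.symm hv, AddChar.map_add_eq_mul] at h1
    rw [Fintype.sum_prod_type] at h1
    simp only [← Finset.mul_sum, ← Finset.sum_mul] at h1
    have h2 : ∑ t : ZMod 8, quarticChar (t * t) = 4 * (1 + ⟨0, 1⟩) := by
      simp only [quarticChar, AddChar.zmodChar_apply]
      decide
    have h3 : (4 * (1 + ⟨0, 1⟩) : GaussianInt) ≠ 0 := by decide
    rw [h2] at h1
    refine mul_left_cancel₀ h3 (h1.trans ?_)
    ring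

/-- The tuples of `r + 1` pairwise orthogonal vectors of norms `1, …, 1, a`. They are not required to
span. -/
def frames (B : LinearMap.BilinForm (ZMod 8) V) (r : ℕ) (a : ZMod 8) : Set (Fin (r + 1) → V) :=
  {f | ∀ i j, B (f i) (f j) = if i = j then (if i = Fin.last r then a else 1) else 0}

/-- A frame amounts to its first vector `v`, of norm `1`, together with a frame of `v^⊥`. -/
def framesSuccEquiv {B : LinearMap.BilinForm (ZMod 8) V} (hB : ∀ x y, B x y = B y x)
    (r : ℕ) (a : ZMod 8) :
    frames B (r + 1) a ≃
      Σ v : {v : V // B v v = 1}, frames (B.restrict (LinearMap.ker (B v.1))) r a where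
  toFun f := ⟨⟨f.1 0, by rw [f.2 0 0, if_pos rfl, if_neg (Fin.last_pos.ne)]⟩,
    fun i => ⟨f.1 i.succ, by
      rw [LinearMap.mem_ker, f.2, if_neg (Fin.succ_ne_zero i).symm]⟩,
    fun i j => by
      have := f.2 i.succ j.succ
      simp only [Fin.succ_inj, ← Fin.succ_last] at this
      exact this⟩
  invFun p := ⟨Fin.cons p.1.1 fun i => (p.2.1 i : V), by
    intro i j
    have h0 : ∀ i, B p.1.1 (p.2.1 i) = 0 := fun i => (p.2.1 i).2
    have h1 : ∀ i j, B (p.2.1 i) (p.2.1 j) = _ := p.2.2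
    refine Fin.cases ?_ (fun i => ?_) i <;> refine Fin.cases ?_ (fun j => ?_) j
    · simp [p.1.2, Fin.last_pos.ne]
    · simp [h0, (Fin.succ_ne_zero j).symm]
    · simp [hB _ p.1.1, h0]
    · simp only [Fin.cons_succ, h1, Fin.succ_inj, ← Fin.succ_last]⟩
  left_inv f := by
    ext i
    refine Fin.cases ?_ (fun i => ?_) i <;> simp
  right_inv p := by
    rcases p with ⟨⟨v, hv⟩, g, hg⟩
    rfl

lemma frames_ker_eq_empty {B : LinearMap.BilinForm (ZMod 8) V} (hB : ∀ x y, B x y = B y x)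
    {v : V} (hv : B v v = 1) (hchar : v ∈ characteristicVectors B) (r : ℕ) {a : ZMod 8}
    (ha : 4 * a = 4) : frames (B.restrict (LinearMap.ker (B v))) r a = ∅ := by
  rw [Set.eq_empty_iff_forall_notMem]
  intro f hf
  have h1 := hf (Fin.last r) (Fin.last r)
  rw [if_pos rfl, if_pos rfl] at h1
  have h2 := (mem_char_iff_ker_even hB hv).1 hchar _ (f (Fin.last r)).2
  change B (f (Fin.last r) : V) (f (Fin.last r) : V) = a at h1
  rw [h1, ha] at h2
  exact absurd h2 (by decide)

/-- In rank one the vectors of norm `a` are exactly the characteristic vectors: both the latter and the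
vectors of odd norm make up half of the module. -/
lemma HasDiagonalInvariants.card_frames_zero [Fintype V] {B : LinearMap.BilinForm (ZMod 8) V}
    {a : ZMod 8} (ha : 4 * a = 4) (h : HasDiagonalInvariants B 0 a) :
    Nat.card (frames B 0 a) = 4 := by
  classical
  have e : frames B 0 a ≃ {v : V | B v v = a} :=
    (Equiv.funUnique (Fin 1) V).subtypeEquiv fun f => by
      change (∀ i j : Fin 1, _) ↔ B _ _ = a
      simp [Fin.forall_fin_one]
  rw [Nat.card_congr e]
  have hsub : (characteristicVectors B).toFinset ⊆
      Finset.univ.filter fun x => 4 * B x x ≠ 0 := by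
    intro x hx
    rw [Set.mem_toFinset] at hx
    rw [Finset.mem_filter, h.norm_char x hx]
    simp only [Finset.mem_univ, true_and, Nat.cast_zero, zero_add, ha]
    decide
  have h1 := two_mul_card_odd_norm h.symm h.odd
  have h2 := h.card_char
  have h3 := h.card_eq
  rw [Nat.card_eq_fintype_card] at h3
  rw [Nat.card_eq_fintype_card, ← Set.toFinset_card] at h2
  have h4 := Finset.eq_of_subset_of_card_le hsub (by omega)
  have h5 : {v : V | B v v = a} = characteristicVectors B := by
    ext x
    refine ⟨fun hx => ?_, fun hx => by simpa using h.norm_char x hx⟩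
    rw [← Set.mem_toFinset, h4, Finset.mem_filter]
    have hx' : B x x = a := hx
    rw [hx', ha]
    exact ⟨Finset.mem_univ _, by decide⟩
  rw [h5, h.card_char]
  norm_num

/-- The number of frames with norms `1, …, 1, a` (`r` ones), given by its recursion in `r`. -/
def frameCount (a : ZMod 8) : ℕ → ℤ
  | 0 => 4
  | r + 1 => normOneCount (r + 1) a * frameCount a r

theorem HasDiagonalInvariants.card_frames {a : ZMod 8} (ha : 4 * a = 4) (r : ℕ) :
    ∀ {V : Type*} [AddCommGroup V] [Module (ZMod 8) V] [Fintype V]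
      {B : LinearMap.BilinForm (ZMod 8) V}, HasDiagonalInvariants B r a →
      (Nat.card (frames B r a) : ℤ) = frameCount a r := by
  classical
  induction r with
  | zero =>
    intro V _ _ _ B h
    rw [h.card_frames_zero ha, frameCount]; rfl
  | succ r ih =>
    intro V _ _ _ B h
    rw [Nat.card_congr (framesSuccEquiv h.symm r a), Nat.card_sigma, frameCount,
      ← h.card_norm_one]
    have h1 : ∀ v : {v : V // B v v = 1},
        (Nat.card (frames (B.restrict (LinearMap.ker (B v.1))) r a) : ℤ) =
          if v.1 ∈ characteristicVectors B then 0 else frameCount a r := by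
      rintro ⟨v, hv⟩
      split_ifs with hc
      · rw [frames_ker_eq_empty h.symm hv hc r ha]; simp
      · exact ih (h.ker hv hc)
    push_cast
    rw [Finset.sum_congr rfl fun v _ => h1 v,
      ← Finset.sum_subtype (Finset.univ.filter fun v => B v v = 1) (by simp)
        (fun v => if v ∈ characteristicVectors B then 0 else frameCount a r),
      Finset.sum_ite, Finset.sum_const_zero, zero_add, Finset.sum_const, Finset.filter_filter,
      nsmul_eq_mul]
    simp only [and_comm]

/-! ### The diagonal form and its frames as units -/

/-- The bilinear form over `ℤ/8` with diagonal Gram matrix `⟨1, …, 1, a⟩` (`r` ones). -/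
def diagonalForm (r : ℕ) (a : ZMod 8) : LinearMap.BilinForm (ZMod 8) (Fin (r + 1) → ZMod 8) :=
  Matrix.toBilin' (Matrix.diagonal fun i => if i = Fin.last r then a else 1)

lemma diagonalForm_apply (r : ℕ) (a : ZMod 8) (x y : Fin (r + 1) → ZMod 8) :
    diagonalForm r a x y = ∑ i, (if i = Fin.last r then a else 1) * (x i * y i) := by
  simp only [diagonalForm, Matrix.toBilin'_apply', dotProduct, Matrix.mulVec_diagonal]
  exact Finset.sum_congr rfl fun i _ => by ring

/-- The columns of a unit of the form are a frame. -/
lemma numUnits_eq_card_frames (n d : ℕ) :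
    numUnits 8 (formMatrix n d) =
      Nat.card (frames (diagonalForm n (-(d : ZMod 8))) n (-(d : ZMod 8))) := by
  refine Nat.card_congr ((Matrix.transposeAddEquiv _ _ _).toEquiv.subtypeEquiv fun A => ?_)
  have hS : (formMatrix n d).map (Int.cast : ℤ → ZMod 8) =
      Matrix.diagonal fun i => if i = Fin.last n then -(d : ZMod 8) else 1 := by
    rw [formMatrix, Matrix.diagonal_map Int.cast_zero]
    congr 1
    ext i
    split_ifs <;> simp
  rw [hS, ← Matrix.ext_iff]
  refine forall_congr' fun i => forall_congr' fun j => ?_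
  rw [diagonalForm_apply, Matrix.mul_apply, Matrix.diagonal_apply]
  simp only [Matrix.mul_diagonal]
  refine Eq.congr_left (Finset.sum_congr rfl fun k _ => ?_)
  simp only [AddEquiv.toEquiv_eq_coe, EquivLike.coe_coe, Matrix.transposeAddEquiv_apply,
    Matrix.transpose_apply]
  ring

lemma mem_characteristicVectors_diagonalForm {r : ℕ} {a : ZMod 8} (ha : 4 * a = 4)
    (x : Fin (r + 1) → ZMod 8) :
    x ∈ characteristicVectors (diagonalForm r a) ↔ ∀ i, 4 * x i = 4 := by
  have hu : ∀ i : Fin (r + 1), (4 * if i = Fin.last r then a else 1) = 4 := by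
    intro i; split_ifs <;> simp [ha]
  have h4 : ∀ x y : Fin (r + 1) → ZMod 8, 4 * diagonalForm r a x y = ∑ i, 4 * (x i * y i) := by
    intro x y
    rw [diagonalForm_apply, Finset.mul_sum]
    exact Finset.sum_congr rfl fun i _ => by rw [← mul_assoc, hu]
  simp only [characteristicVectors, Set.mem_ofPred_eq, h4]
  constructor
  · intro h i
    simpa [Pi.single_apply] using h (Pi.single i 1)
  · intro h y
    refine Finset.sum_congr rfl fun i _ => ?_
    rw [← mul_assoc, h i]
    generalize y i = t
    revert t; decide

lemma hasDiagonalInvariants_diagonalForm (r : ℕ) {a : ZMod 8} (ha : 4 * a = 4) :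
    HasDiagonalInvariants (diagonalForm r a) r a := by
  refine ⟨fun x y => ?_, ?_, ?_, ?_, ?_, ?_⟩
  · simp only [diagonalForm_apply, mul_comm (x _)]
  · simp
  · have e : characteristicVectors (diagonalForm r a) ≃ (Fin (r + 1) → {t : ZMod 8 // 4 * t = 4}) :=
      ((Equiv.refl _).subtypeEquiv fun x => mem_characteristicVectors_diagonalForm ha x).trans
        (Equiv.subtypePiEquivPi (p := fun (_ : Fin (r + 1)) (t : ZMod 8) => 4 * t = 4))
    have h : Nat.card {t : ZMod 8 // 4 * t = 4} = 4 := by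
      rw [Nat.card_eq_fintype_card]; decide
    rw [Nat.card_congr e, Nat.card_fun, h, Nat.card_fin]
  · intro x hx
    rw [mem_characteristicVectors_diagonalForm ha] at hx
    have h1 : ∀ t : ZMod 8, 4 * t = 4 → t * t = 1 := by decide
    simp only [diagonalForm_apply, h1 _ (hx _), mul_one]
    rw [Fin.sum_univ_castSucc]
    simp [Fin.castSucc_ne_last]
  · refine ⟨Pi.single (Fin.last r) 1, ?_⟩
    rw [diagonalForm_apply, Finset.sum_eq_single (Fin.last r)]
    · simp only [if_pos, Pi.single_eq_same, mul_one, ha]; decide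
    · intro i _ hi; simp [hi]
    · simp
  · have h1 : ∀ x : Fin (r + 1) → ZMod 8, quarticChar (diagonalForm r a x x) =
        ∏ i, quarticChar ((if i = Fin.last r then a else 1) * x i ^ 2) := by
      intro x
      rw [diagonalForm_apply]
      simp only [sq]
      exact map_prod quarticChar.toMonoidHom (fun i => Multiplicative.ofAdd _) _
    simp only [h1]
    rw [← Fintype.prod_sum (fun i t => quarticChar ((if i = Fin.last r then a else 1) * t ^ 2)),
      Fin.prod_univ_castSucc]
    simp only [Fin.castSucc_ne_last, if_false, if_true]
    rw [sum_quarticChar_sq ha, sum_quarticChar_sq (mul_one 4), Finset.prod_const, Finset.card_univ,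
      Fintype.card_fin]
    have : quarticChar 1 = ⟨0, 1⟩ := by
      rw [quarticChar, AddChar.zmodChar_apply]; decide
    rw [this, mul_pow, pow_succ]
    ring

/-! ### The closed formula -/

lemma sqrt_two_mul_cos_add_pi_div_four (t : ℝ) :
    √2 * Real.cos (t + Real.pi / 4) = Real.cos t - Real.sin t := by
  rw [Real.cos_add, Real.cos_pi_div_four, Real.sin_pi_div_four]
  linear_combination (Real.cos t - Real.sin t) / 2 * Real.mul_self_sqrt (zero_le_two (α := ℝ))

lemma sqrt_two_mul_sin_add_pi_div_four (t : ℝ) :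
    √2 * Real.sin (t + Real.pi / 4) = Real.cos t + Real.sin t := by
  rw [Real.sin_add, Real.cos_pi_div_four, Real.sin_pi_div_four]
  linear_combination (Real.cos t + Real.sin t) / 2 * Real.mul_self_sqrt (zero_le_two (α := ℝ))

/-- The polar form of `(1 + i) ^ n * (1 ± i)`. -/
lemma gaussianInt_pow_re_im {ε : ℤ} (hε : ε = 1 ∨ ε = -1) (n : ℕ) :
    ((((1 + ⟨0, 1⟩ : GaussianInt) ^ n * (1 + ⟨0, ε⟩)).re : ℤ) : ℝ) =
        √2 ^ (n + 1) * Real.cos ((n + ε) * Real.pi / 4) ∧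
      ((((1 + ⟨0, 1⟩ : GaussianInt) ^ n * (1 + ⟨0, ε⟩)).im : ℤ) : ℝ) =
        √2 ^ (n + 1) * Real.sin ((n + ε) * Real.pi / 4) := by
  have h2 := Real.mul_self_sqrt (zero_le_two (α := ℝ))
  induction n with
  | zero =>
    rcases hε with rfl | rfl
    · simp only [pow_zero, one_mul, Int.cast_one, Nat.cast_zero, zero_add, pow_one,
        Real.cos_pi_div_four, Real.sin_pi_div_four]
      constructor <;> simp <;> linear_combination -h2 / 2
    · simp only [pow_zero, one_mul, Int.cast_neg, Int.cast_one, Nat.cast_zero, zero_add, pow_one,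
        neg_mul, neg_div, Real.cos_neg, Real.sin_neg, Real.cos_pi_div_four, Real.sin_pi_div_four]
      constructor <;> simp <;> linear_combination -h2 / 2
  | succ n ih =>
    obtain ⟨h1, h3⟩ := ih
    have ht : (((n + 1 : ℕ) : ℝ) + ε) * Real.pi / 4 = (n + ε) * Real.pi / 4 + Real.pi / 4 := by
      push_cast; ring
    rw [ht, pow_succ' _ n, mul_assoc, pow_succ _ (n + 1), mul_assoc, mul_assoc,
      sqrt_two_mul_cos_add_pi_div_four, sqrt_two_mul_sin_add_pi_div_four]
    generalize (1 + ⟨0, 1⟩ : GaussianInt) ^ n * (1 + ⟨0, ε⟩) = z at h1 h3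
    rw [Zsqrtd.re_mul, Zsqrtd.im_mul]
    simp only [Zsqrtd.re_add, Zsqrtd.im_add, Zsqrtd.re_one, Zsqrtd.im_one]
    push_cast
    rw [h1, h3]
    constructor <;> ring

/-- With `X = √2 ^ n` the first factor is `normOneCount n a / 4 ^ n`. The summands `√2 cos` and
`√2 sin` on the right come from the cosine for `n - 1`, so that this is one step of the recursion. -/
lemma normOneCount_factor {a : ZMod 8} {ε : ℤ}
    (hε : (a = 1 ∨ a = 5) ∧ ε = 1 ∨ (a = 3 ∨ a = 7) ∧ ε = -1)
    (n : ℕ) (X : ℝ) :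
    (X ^ 2 + √2 * Real.sin ((n + ε) * Real.pi / 4) * X -
          2 * (if (n + a : ZMod 8) = 1 ∨ (n + a : ZMod 8) = 5 then 1 else 0)) *
        (X + √2 * Real.cos ((n + ε) * Real.pi / 4)) =
      (X ^ 2 - if Even n then 1 else 0) *
        (X + √2 * Real.cos ((n + ε) * Real.pi / 4) + √2 * Real.sin ((n + ε) * Real.pi / 4)) := by
  -- everything depends on `σ = n + ε` modulo `8` only
  obtain ⟨σ, hσ⟩ : ∃ σ : ℤ, σ = n + ε := ⟨_, rfl⟩
  have hδ : ((n + a : ZMod 8) = 1 ∨ (n + a : ZMod 8) = 5) ↔ σ % 4 = 1 := by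
    have h8 : σ % 4 = 1 ↔ (2 * σ : ZMod 8) = 2 := by
      have : (2 * σ : ZMod 8) = 2 ↔ ((2 * σ : ℤ) : ZMod 8) = ((2 : ℤ) : ZMod 8) := by push_cast; rfl
      rw [this, ZMod.intCast_eq_intCast_iff]
      rw [Int.ModEq]
      omega
    rw [h8, hσ]
    push_cast
    generalize (n : ZMod 8) = m
    rcases hε with ⟨h | h, rfl⟩ | ⟨h | h, rfl⟩ <;> subst h <;> push_cast <;> revert m <;> decide
  have heven : Even n ↔ σ % 2 = 1 := by
    rw [Nat.even_iff, hσ]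
    rcases hε with ⟨-, rfl⟩ | ⟨-, rfl⟩ <;> omega
  have hθ : ((n : ℝ) + ε) * Real.pi / 4 =
      ((σ % 8 : ℤ) : ℝ) * Real.pi / 4 + ((σ / 8 : ℤ) : ℝ) * (2 * Real.pi) := by
    have h : (σ : ℝ) = ((σ % 8 : ℤ) : ℝ) + 8 * ((σ / 8 : ℤ) : ℝ) := by
      exact_mod_cast (Int.emod_add_mul_ediv σ 8).symm
    have h' : (σ : ℝ) = n + ε := by rw [hσ]; push_cast; rfl
    rw [← h', h]; ring
  simp only [hδ, heven]
  rw [hθ, Real.cos_add_int_mul_two_pi, Real.sin_add_int_mul_two_pi]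
  have hj0 : 0 ≤ σ % 8 := by omega
  have hj8 : σ % 8 < 8 := by omega
  have h4 : σ % 4 = σ % 8 % 4 := by omega
  have h22 : σ % 2 = σ % 8 % 2 := by omega
  rw [h4, h22]
  generalize σ % 8 = j at hj0 hj8
  have quarter : ∀ j : ℤ,
      Real.cos (((j + 2 : ℤ) : ℝ) * Real.pi / 4) = -Real.sin (j * Real.pi / 4) ∧
        Real.sin (((j + 2 : ℤ) : ℝ) * Real.pi / 4) = Real.cos (j * Real.pi / 4) := by
    intro j
    have ht : ((j + 2 : ℤ) : ℝ) * Real.pi / 4 = j * Real.pi / 4 + Real.pi / 2 := by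
      push_cast; ring
    rw [ht]
    exact ⟨Real.cos_add_pi_div_two _, Real.sin_add_pi_div_two _⟩
  have eighth : ∀ j : ℤ,
      √2 * Real.cos (((j + 1 : ℤ) : ℝ) * Real.pi / 4) =
          Real.cos (j * Real.pi / 4) - Real.sin (j * Real.pi / 4) ∧
        √2 * Real.sin (((j + 1 : ℤ) : ℝ) * Real.pi / 4) =
          Real.cos (j * Real.pi / 4) + Real.sin (j * Real.pi / 4) := by
    intro j
    have ht : ((j + 1 : ℤ) : ℝ) * Real.pi / 4 = j * Real.pi / 4 + Real.pi / 4 := by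
      push_cast; ring
    rw [ht]
    exact ⟨sqrt_two_mul_cos_add_pi_div_four _, sqrt_two_mul_sin_add_pi_div_four _⟩
  have v0 : Real.cos (((0 : ℤ) : ℝ) * Real.pi / 4) = 1 ∧
      Real.sin (((0 : ℤ) : ℝ) * Real.pi / 4) = 0 := by simp
  have v2 := quarter 0
  simp only [v0, Int.reduceAdd] at v2
  have v4 := quarter 2
  simp only [v2, Int.reduceAdd] at v4
  have v6 := quarter 4
  simp only [v4, Int.reduceAdd] at v6
  have v1 := eighth 0
  simp only [v0, Int.reduceAdd] at v1
  have v3 := eighth 2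
  simp only [v2, Int.reduceAdd] at v3
  have v5 := eighth 4
  simp only [v4, Int.reduceAdd] at v5
  have v7 := eighth 6
  simp only [v6, Int.reduceAdd] at v7
  interval_cases j <;>
    simp only [Int.reduceMod, Int.reduceEq, reduceIte, v0, v1, v2, v3, v4, v5, v6, v7] <;> ring

/-- The closed form of the recursion for the number of frames. The factor `1 - 4⁻ᵏ` enters when `r`
reaches `2k`. -/
lemma frameCount_mul {a : ZMod 8} {ε : ℤ}
    (hε : (a = 1 ∨ a = 5) ∧ ε = 1 ∨ (a = 3 ∨ a = 7) ∧ ε = -1) (r : ℕ) :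
    (frameCount a r : ℝ) * (√2 ^ r + √2 * Real.cos ((r + ε) * Real.pi / 4)) =
      2 * √2 ^ (3 * r * (r + 1)) * √2 ^ (r + 4) *
        ∏ k ∈ Finset.Icc 1 (r / 2), (1 - (1 / 4 : ℝ) ^ k) := by
  have h2 := Real.mul_self_sqrt (zero_le_two (α := ℝ))
  have hε1 : ε = 1 ∨ ε = -1 := by tauto
  have hval : (⟨0, 1⟩ : GaussianInt) ^ a.val = ⟨0, ε⟩ := by
    rcases hε with ⟨h | h, rfl⟩ | ⟨h | h, rfl⟩ <;> subst h <;> decide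
  have hsq : ∀ n : ℕ, (√2 ^ n) ^ 2 = 2 ^ n := fun n => by
    rw [← pow_mul, mul_comm, pow_mul, sq, h2]
  induction r with
  | zero =>
    have hc : Real.cos (((0 : ℕ) + (ε : ℝ)) * Real.pi / 4) = √2 / 2 := by
      rcases hε1 with rfl | rfl
      · simp [Real.cos_pi_div_four]
      · simp [neg_div, Real.cos_pi_div_four]
    rw [hc]
    have h4 : √2 ^ 4 = 4 := by rw [show 4 = 2 * 2 from rfl, pow_mul, sq √2, h2]; norm_num
    simp [frameCount, h4]
    linear_combination 2 * h2
  | succ r ih =>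
    have hN : (normOneCount (r + 1) a : ℝ) = 4 ^ (r + 1) *
        ((√2 ^ (r + 1)) ^ 2 + √2 * Real.sin (((r + 1 : ℕ) + ε) * Real.pi / 4) * √2 ^ (r + 1) -
          2 * (if (((r + 1 : ℕ) : ZMod 8) + a : ZMod 8) = 1 ∨
            (((r + 1 : ℕ) : ZMod 8) + a : ZMod 8) = 5 then 1 else 0)) := by
      rw [normOneCount, hval, hsq]
      push_cast only [Int.cast_add, Int.cast_mul, Int.cast_sub, Int.cast_pow, Int.cast_ofNat,
        Int.cast_ite, Int.cast_one, Int.cast_zero]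
      rw [(gaussianInt_pow_re_im hε1 (r + 1)).2, show (8 : ℝ) = 4 * 2 by norm_num, mul_pow]
      ring
    -- the right-hand factor of `normOneCount_factor` is `√2` times the factor in the claim for `r`
    have hprev : √2 * (√2 ^ r + √2 * Real.cos ((r + ε) * Real.pi / 4)) =
        √2 ^ (r + 1) + √2 * Real.cos (((r + 1 : ℕ) + ε) * Real.pi / 4) +
          √2 * Real.sin (((r + 1 : ℕ) + ε) * Real.pi / 4) := by
      have ht : (((r + 1 : ℕ) : ℝ) + ε) * Real.pi / 4 = (r + ε) * Real.pi / 4 + Real.pi / 4 := by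
        push_cast; ring
      rw [ht, sqrt_two_mul_cos_add_pi_div_four, sqrt_two_mul_sin_add_pi_div_four]
      linear_combination Real.cos ((r + ε) * Real.pi / 4) * h2
    have hprod : (2 ^ (r + 1) : ℝ) * ∏ k ∈ Finset.Icc 1 ((r + 1) / 2), (1 - (1 / 4 : ℝ) ^ k) =
        (2 ^ (r + 1) - if Even (r + 1) then 1 else 0) *
          ∏ k ∈ Finset.Icc 1 (r / 2), (1 - (1 / 4 : ℝ) ^ k) := by
      split_ifs with hev
      · obtain ⟨m, hm⟩ := hev
        have hm1 : (r + 1) / 2 = r / 2 + 1 := by omega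
        have hm2 : r + 1 = 2 * (r / 2 + 1) := by omega
        rw [hm1, Finset.prod_Icc_succ_top (by omega), hm2, pow_mul]
        have : ((2 : ℝ) ^ 2) ^ (r / 2 + 1) * (1 / 4) ^ (r / 2 + 1) = 1 := by
          rw [← mul_pow]; norm_num
        linear_combination -(∏ k ∈ Finset.Icc 1 (r / 2), (1 - (1 / 4 : ℝ) ^ k)) * this
      · have hm1 : (r + 1) / 2 = r / 2 := by rw [Nat.even_iff] at hev; omega
        rw [hm1, sub_zero]
    have hpow : √2 ^ (3 * (r + 1) * (r + 1 + 1)) * √2 ^ (r + 1 + 4) =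
        4 ^ (r + 1) * 2 ^ (r + 1) * √2 * (√2 ^ (3 * r * (r + 1)) * √2 ^ (r + 4)) := by
      rw [← mul_pow, show (4 * 2 : ℝ) = √2 ^ 6 by
        rw [show 6 = 2 * 3 from rfl, pow_mul, sq, h2]; norm_num]
      ring
    have hfac := normOneCount_factor hε (r + 1) (√2 ^ (r + 1))
    rw [frameCount, Int.cast_mul, hN, mul_right_comm, mul_assoc (4 ^ (r + 1)), hfac, ← hprev, hsq,
      mul_assoc 2, hpow]
    set C := √2 ^ r + √2 * Real.cos ((r + ε) * Real.pi / 4)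
    linear_combination (4 ^ (r + 1) * (2 ^ (r + 1) - if Even (r + 1) then 1 else 0) * √2) * ih -
      2 * 4 ^ (r + 1) * √2 * (√2 ^ (3 * r * (r + 1)) * √2 ^ (r + 4)) * hprod

theorem corollary1 (n d : ℕ) (hn : 2 ≤ n) (hodd : Odd d) (hsq : Squarefree d) :
    2 * (2 : ℝ) ^ (3 * (n : ℝ) * ((n : ℝ) + 1) / 2) / (numUnits 8 (formMatrix n d) : ℝ) =
      ((2 : ℝ) ^ (((n : ℝ) - 1) / 2) +
          Real.cos (((n : ℝ) + (-1 : ℝ) ^ ((d + 1) / 2)) * Real.pi / 4)) /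
        ((2 : ℝ) ^ (((n : ℝ) + 3) / 2) *
          ∏ k ∈ Finset.Icc 1 (n / 2), (1 - (2 : ℝ) ^ (-(2 * (k : ℝ))))) := by
  -- the sign `ε` is `1` or `-1` according as `-d` is `1` or `3` modulo `4`
  obtain ⟨ε, hε, hεd⟩ : ∃ ε : ℤ, ((-(d : ZMod 8) = 1 ∨ -(d : ZMod 8) = 5) ∧ ε = 1 ∨
      (-(d : ZMod 8) = 3 ∨ -(d : ZMod 8) = 7) ∧ ε = -1) ∧ (-1 : ℝ) ^ ((d + 1) / 2) = ε := by
    have hd8 : (d : ZMod 8) = ((d % 8 : ℕ) : ZMod 8) := by simp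
    obtain ⟨m, rfl⟩ := hodd
    rcases Nat.even_or_odd (m + 1) with h | h
    · refine ⟨1, Or.inl ⟨?_, rfl⟩, ?_⟩
      · have : (2 * m + 1) % 8 = 3 ∨ (2 * m + 1) % 8 = 7 := by rw [Nat.even_iff] at h; omega
        rcases this with h | h <;> rw [hd8, h] <;> decide
      · rw [show (2 * m + 1 + 1) / 2 = m + 1 by omega, h.neg_one_pow]; simp
    · refine ⟨-1, Or.inr ⟨?_, rfl⟩, ?_⟩
      · have : (2 * m + 1) % 8 = 1 ∨ (2 * m + 1) % 8 = 5 := by rw [Nat.odd_iff] at h; omega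
        rcases this with h | h <;> rw [hd8, h] <;> decide
      · rw [show (2 * m + 1 + 1) / 2 = m + 1 by omega, h.neg_one_pow]; simp
  have ha : 4 * -(d : ZMod 8) = 4 := by
    rcases hε with ⟨h | h, -⟩ | ⟨h | h, -⟩ <;> rw [h] <;> decide
  have hcard := (hasDiagonalInvariants_diagonalForm n ha).card_frames ha n
  rw [← numUnits_eq_card_frames] at hcard
  have hcardR : (numUnits 8 (formMatrix n d) : ℝ) = (frameCount (-(d : ZMod 8)) n : ℝ) := by
    exact_mod_cast congrArg (Int.cast : ℤ → ℝ) hcard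
  have hmain := frameCount_mul hε n
  rw [← hcardR] at hmain
  have hrpow : ∀ x : ℝ, (2 : ℝ) ^ (x / 2) = √2 ^ x := fun x => by
    rw [Real.sqrt_eq_rpow, ← Real.rpow_mul zero_le_two]; congr 1; ring
  have hs : (0 : ℝ) < √2 := by positivity
  have e1 : (2 : ℝ) ^ (3 * (n : ℝ) * ((n : ℝ) + 1) / 2) = √2 ^ (3 * n * (n + 1)) := by
    rw [hrpow, ← Real.rpow_natCast]; push_cast; rfl
  have e2 : √2 * (2 : ℝ) ^ (((n : ℝ) - 1) / 2) = √2 ^ n := by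
    rw [hrpow, Real.rpow_sub_one hs.ne', Real.rpow_natCast]
    field_simp
  have e3 : √2 * (2 : ℝ) ^ (((n : ℝ) + 3) / 2) = √2 ^ (n + 4) := by
    rw [hrpow, show (n : ℝ) + 3 = ((n + 3 : ℕ) : ℝ) by push_cast; rfl, Real.rpow_natCast]
    ring
  have e4 : ∀ k : ℕ, (2 : ℝ) ^ (-(2 * (k : ℝ))) = (1 / 4) ^ k := fun k => by
    rw [Real.rpow_neg zero_le_two, Real.rpow_mul zero_le_two, Real.rpow_natCast, one_div, inv_pow]
    norm_num
  simp only [e4]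
  rw [e1, hεd]
  have hprod : 0 < ∏ k ∈ Finset.Icc 1 (n / 2), (1 - (1 / 4 : ℝ) ^ k) :=
    Finset.prod_pos fun k hk => sub_pos.2 <|
      pow_lt_one₀ (by norm_num) (by norm_num) (by have := (Finset.mem_Icc.1 hk).1; omega)
  have hE : (numUnits 8 (formMatrix n d) : ℝ) ≠ 0 := by
    intro h0
    rw [h0, zero_mul] at hmain
    exact absurd hmain (by positivity)
  rw [div_eq_div_iff hE (by positivity)]
  refine mul_left_cancel₀ hs.ne' ?_
  rw [← e2, ← e3] at hmain
  linear_combination -hmain
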